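/- Let $d\ge 1$ and let $\mathcal M$ be the set of simple locally finite point configurations $\gamma$ in $\mathbb R^d$, with the $\sigma$-algebra generated by the events $\{\gamma(\Lambda)=n\}$, where $n\in\mathbb N$ and $\Lambda\in\mathcal B$, the bounded Borel subsets of $\mathbb R^d$. Write $\gamma_\Lambda$ for the restriction of $\gamma$ to $\Lambda$ and $\gamma_y$ for $\gamma$ translated by $y$. A family of energies is a family of measurable functions $H_\Lambda:\mathcal M\to\mathbb R\cup\{+\infty\}$, $\Lambda\in\mathcal B$, such that for all $\Lambda\subset\Lambda'$ in $\mathcal B$ there is a measurable $\varphi_{\Lambda,\Lambda'}:\mathcal M\to\mathbb R\cup\{+\infty\}$ with $H_{\Lambda'}(\gamma)=H_\Lambda(\gamma)+\varphi_{\Lambda,\Lambda'}(\gamma_{\Lambda^c})$ for all $\gamma\in\mathcal M$. For such a family let $\mathcal M_\infty$ be the set of the $\gamma$ with $H_\Lambda(\gamma)<\infty$ for all $\Lambda\in\mathcal B$. For $\gamma\in\mathcal M_\infty$ and $x\notin\gamma$ the local energy is $h(x,\gamma)=H_\Lambda(\gamma+\delta_x)-H_\Lambda(\gamma)$, where $\Lambda\in\mathcal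 B$ is any set containing $x$ (the value does not depend on $\Lambda$). A Gibbs measure for $(H_\Lambda)$ is a probability measure $\mu$ on $\mathcal M$ such that, for every $\Lambda\in\mathcal B$, $0<Z_\Lambda(\gamma_{\Lambda^c})<\infty$ for $\mu$-a.e. $\gamma$ and, for every measurable $f:\mathcal M\to[0,\infty]$, $$\int f\,d\mu=\int\frac{1}{Z_\Lambda(\gamma_{\Lambda^c})}\int f(\gamma'_\Lambda+\gamma_{\Lambda^c})\,e^{-H_\Lambda(\gamma'_\Lambda+\gamma_{\Lambda^c})}\,\pi_\Lambda(d\gamma')\,\mu(d\gamma),$$ where $\pi_\Lambda$ is the unit-rate Poisson process on $\Lambda$ and $Z_\Lambda(\gamma_{\Lambda^c})=\int e^{-H_\Lambda(\gamma'_\Lambda+\gamma_{\Lambda^c})}\,\pi_\Lambda(d\gamma')$. Let $\Theta\subset\mathbb R^p$ be bounded and open, and for all $\alpha>0$ and $\theta\in\Theta$ let $(H^{\alpha,\theta}_\Lambda)_{\Lambda\in\mathcal B}$ be a family of energies, with $\mathcal M^{\alpha,\theta}_\infty$ and $h^{\alpha,\theta}$ the objects defined from it as above, and with $\mathcal G^{\alpha,\theta}$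 the set of its translation-invariant Gibbs measures. Let $\alpha^*>0$, $\theta^*\in\Theta$ and $\mu\in\mathcal G^{\alpha^*,\theta^*}$. Assume the following. - (S1) For all $\gamma\in\mathcal M$, $\Lambda\in\mathcal B$, $\alpha>0$ and $\theta,\theta'\in\Theta$: $H^{\alpha,\theta}_\Lambda(\gamma)<\infty$ if and only if $H^{\alpha,\theta'}_\Lambda(\gamma)<\infty$. - (S2) For all $\gamma\in\mathcal M$, $\Lambda\in\mathcal B$, $\theta\in\Theta$ and $0<\alpha\le\alpha'$: if $H^{\alpha,\theta}_\Lambda(\gamma)<\infty$, then $H^{\alpha',\theta}_\Lambda(\gamma)<\infty$. - (S3) For every $0<\alpha<\alpha^*$ there is $R_\alpha>0$ such that $\nu\big(H^{\alpha,\theta^*}_{B(0,R_\alpha)}(\gamma)=+\infty\big)>0$ for every $\nu\in\mathcal G^{\alpha^*,\theta^*}$. - (H1) $(\Lambda_n)$ is an increasing sequence of convex compact sets with $\bigcup_n\Lambda_n=\mathbb R^d$. - (H2) The local energy, together with its domain, is invariant under translation: for all $\alpha>0$, $\theta\in\Theta$, $\gamma\in\mathcal M^{\alpha,\theta}_\infty$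 and $y\in\mathbb R^d$ one has $\gamma_y\in\mathcal M^{\alpha,\theta}_\infty$, and $h^{\alpha,\theta}(x+y,\gamma_y)=h^{\alpha,\theta}(x,\gamma)$ for all $x\notin\gamma$. - (H3) There is $K\ge0$ such that $h^{\alpha,\theta}(x,\gamma)\ge-K$ for all $\alpha>0$, $\theta\in\Theta$, $\gamma\in\mathcal M^{\alpha,\theta}_\infty$ and $x\notin\gamma$. Then for $\mu$-almost every $\gamma$ and all $\theta\in\Theta$ the estimator $$\hat\alpha_n=\inf\{\alpha>0:\ H^{\alpha,\theta}_{\Lambda_n}(\gamma)<\infty\}$$ is well defined (the set is non-empty) for every $n$, the sequence $(\hat\alpha_n)$ is non-decreasing and bounded above by $\alpha^*$, and $\lim_{n\to\infty}\hat\alpha_n=\alpha^*$. -/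

import Mathlib

open MeasureTheory Filter Topology
open scoped ENNReal

/-- A simple locally finite point configuration in `ℝ^d`. A simple integer-valued measure, finite on
bounded sets, is identified with the set of its atoms; `γ(Λ)` is the number of points in `Λ`. -/
@[ext]
structure Config (d : ℕ) where
  /-- the points of the configuration -/
  carrier : Set (EuclideanSpace ℝ (Fin d))
  /-- a bounded set contains only finitely many points -/
  finite_inter : ∀ Λ : Set (EuclideanSpace ℝ (Fin d)),
    Bornology.IsBounded Λ → (carrier ∩ Λ).Finite

/-- `𝓑(ℝ^d)`: the bounded Borel sets. -/
def IsBoundedBorel {d : ℕ} (Λ : Set (EuclideanSpace ℝ (Fin d))) : Prop :=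
  Bornology.IsBounded Λ ∧ MeasurableSet Λ

namespace Config

variable {d : ℕ}

/-- The number `γ(Λ)` of points of `γ` in `Λ` (meant for bounded `Λ`, where it is finite). -/
noncomputable def count (Λ : Set (EuclideanSpace ℝ (Fin d))) (γ : Config d) : ℕ :=
  (γ.carrier ∩ Λ).ncard

/-- The σ-algebra generated by the events `{γ(Λ) = n}`, `Λ` bounded Borel. -/
instance : MeasurableSpace (Config d) :=
  MeasurableSpace.generateFrom
    {A | ∃ (Λ : Set (EuclideanSpace ℝ (Fin d))) (n : ℕ),
      IsBoundedBorel Λ ∧ A = {γ : Config d | count Λ γ = n}}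

/-- The projection `γ_Λ` of `γ` on `Λ`. -/
def restrict (Λ : Set (EuclideanSpace ℝ (Fin d))) (γ : Config d) : Config d where
  carrier := γ.carrier ∩ Λ
  finite_inter B hB := (γ.finite_inter B hB).subset (by
    rintro x ⟨⟨hx, _⟩, hB'⟩
    exact ⟨hx, hB'⟩)

/-- The superposition of two configurations. -/
def union (γ γ' : Config d) : Config d where
  carrier := γ.carrier ∪ γ'.carrier
  finite_inter B hB := by
    rw [Set.union_inter_distrib_right]
    exact (γ.finite_inter B hB).union (γ'.finite_inter B hB)

/-- `γ'_Λ + γ_{Λᶜ}`: the points of `γ'` inside `Λ` and of `γ` outside `Λ`. -/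
def glue (Λ : Set (EuclideanSpace ℝ (Fin d))) (γ' γ : Config d) : Config d :=
  union (restrict Λ γ') (restrict Λᶜ γ)

/-- `γ + δ_x` (used for points `x` that are not in `γ`). -/
def addPoint (x : EuclideanSpace ℝ (Fin d)) (γ : Config d) : Config d where
  carrier := insert x γ.carrier
  finite_inter B hB := by
    refine ((γ.finite_inter B hB).insert x).subset ?_
    rintro z ⟨hz, hzB⟩
    rcases hz with rfl | hz
    · exact Set.mem_insert _ _
    · exact Set.mem_insert_of_mem _ ⟨hz, hzB⟩

/-- The configuration `γ_y`, that is, `γ` translated by `y`. -/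
def translate (y : EuclideanSpace ℝ (Fin d)) (γ : Config d) : Config d where
  carrier := (fun x => x + y) '' γ.carrier
  finite_inter B hB := by
    have hB' : Bornology.IsBounded ((fun x => x + (-y)) '' B) :=
      (LipschitzWith.of_dist_le_mul (K := 1) (by intro a b; simp)).isBounded_image hB
    refine ((γ.finite_inter _ hB').image (fun x => x + y)).subset ?_
    rintro z ⟨⟨x, hx, rfl⟩, hz⟩
    exact ⟨x, ⟨hx, ⟨x + y, hz, by simp⟩⟩, rfl⟩

/-- The configuration whose points are `x₁, …, xₙ`. -/
def ofPoints {n : ℕ} (x : Fin n → EuclideanSpace ℝ (Fin d)) : Config d where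
  carrier := Set.range x
  finite_inter _ _ := (Set.finite_range x).subset Set.inter_subset_left

/-- `ofPoints` is measurable, so that the image measures below are the intended ones. -/
theorem measurable_ofPoints (n : ℕ) :
    Measurable (ofPoints : (Fin n → EuclideanSpace ℝ (Fin d)) → Config d) := by
  classical
  refine measurable_generateFrom ?_
  rintro _ ⟨Λ, k, ⟨-, hΛ⟩, rfl⟩
  have key : ∀ x : Fin n → EuclideanSpace ℝ (Fin d),
      count Λ (ofPoints x)
        = ∑ i : Fin n, if x i ∈ Λ ∧ ∀ j, j < i → x j ≠ x i then 1 else 0 := by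
    intro x
    rw [Finset.sum_boole, Nat.cast_id]
    have himg : (ofPoints x).carrier ∩ Λ = x ''
        ((Finset.univ.filter fun i => x i ∈ Λ ∧ ∀ j, j < i → x j ≠ x i : Finset (Fin n)) :
          Set (Fin n)) := by
      ext z
      constructor
      · rintro ⟨⟨i, rfl⟩, hz⟩
        obtain ⟨m, hm, hmin⟩ := WellFounded.has_min (wellFounded_lt (α := Fin n))
          {j | x j = x i} ⟨i, rfl⟩
        have hm' : x m = x i := hm
        refine ⟨m, ?_, hm'⟩
        simp only [Finset.coe_filter, Finset.mem_univ, true_and, Set.mem_ofPred_eq]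
        exact ⟨hm' ▸ hz, fun j hj hji => hmin j (hji.trans hm') hj⟩
      · rintro ⟨i, hi, rfl⟩
        simp only [Finset.coe_filter, Finset.mem_univ, true_and, Set.mem_ofPred_eq] at hi
        exact ⟨⟨i, rfl⟩, hi.1⟩
    rw [count, himg, Set.InjOn.ncard_image, Set.ncard_coe_finset]
    intro i hi j hj hij
    simp only [Finset.coe_filter, Finset.mem_univ, true_and, Set.mem_ofPred_eq] at hi hj
    rcases lt_trichotomy i j with h | h | h
    · exact absurd hij (hj.2 i h)
    · exact h
    · exact absurd hij.symm (hi.2 j h)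
  have hmeas : Measurable fun x : Fin n → EuclideanSpace ℝ (Fin d) => count Λ (ofPoints x) := by
    simp only [key]
    refine Finset.measurable_sum _ fun i _ => ?_
    refine Measurable.ite ?_ measurable_const measurable_const
    refine MeasurableSet.inter (measurable_pi_apply i hΛ) ?_
    have : {x : Fin n → EuclideanSpace ℝ (Fin d) | ∀ j, j < i → x j ≠ x i}
        = ⋂ j, ⋂ (_ : j < i), {x | x j = x i}ᶜ := by
      ext x; simp
    change MeasurableSet {x : Fin n → EuclideanSpace ℝ (Fin d) | ∀ j, j < i → x j ≠ x i}
    rw [this]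
    exact MeasurableSet.iInter fun j => MeasurableSet.iInter fun _ =>
      (measurableSet_eq_fun (measurable_pi_apply j) (measurable_pi_apply i)).compl
  exact hmeas (measurableSet_singleton k)

end Config

/-- The Poisson point process `π_Λ` on a bounded Borel set `Λ` with unit intensity: a Poisson number
of points with mean `|Λ|`, which are independent and uniform on `Λ`, that is,
`π_Λ = e^{-|Λ|} ∑ₙ (1/n!) ∫_{Λⁿ} δ_{{x₁, …, xₙ}} dx₁ ⋯ dxₙ`. -/
noncomputable def poissonProcess {d : ℕ} (Λ : Set (EuclideanSpace ℝ (Fin d))) :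
    Measure (Config d) :=
  Measure.sum fun n : ℕ =>
    (ENNReal.ofReal (Real.exp (-(volume Λ).toReal)) / (n.factorial : ℝ≥0∞)) •
      (Measure.pi fun _ : Fin n => volume.restrict Λ).map Config.ofPoints

/-- A family of energies `(H_Λ)`, indexed by the bounded Borel sets, with values in `ℝ ∪ {+∞}`
(only the values of `H` at bounded Borel sets matter). -/
structure IsEnergyFamily {d : ℕ}
    (H : Set (EuclideanSpace ℝ (Fin d)) → Config d → EReal) : Prop where
  measurable : ∀ Λ, IsBoundedBorel Λ → Measurable (H Λ)
  ne_bot : ∀ Λ, IsBoundedBorel Λ → ∀ γ, H Λ γ ≠ ⊥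
  compat : ∀ Λ Λ', IsBoundedBorel Λ → IsBoundedBorel Λ' → Λ ⊆ Λ' →
    ∃ φ : Config d → EReal, Measurable φ ∧ (∀ γ, φ γ ≠ ⊥) ∧
      ∀ γ, H Λ' γ = H Λ γ + φ (γ.restrict Λᶜ)

/-- `𝓜_∞`: the configurations of locally finite energy. -/
def locallyFiniteEnergy {d : ℕ} (H : Set (EuclideanSpace ℝ (Fin d)) → Config d → EReal) :
    Set (Config d) :=
  {γ | ∀ Λ, IsBoundedBorel Λ → H Λ γ < ⊤}

open Classical in
/-- The local energy `h(x, γ) = H_Λ(γ + δ_x) - H_Λ(γ)`, where `Λ` is any bounded Borel set with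
`x ∈ Λ` and `H_Λ(γ) < ∞` (it does not depend on the choice, see `localEnergy_eq`; it is given the
value `0` where no such `Λ` exists, and is only used where one exists and `x ∉ γ`). -/
noncomputable def localEnergy {d : ℕ}
    (H : Set (EuclideanSpace ℝ (Fin d)) → Config d → EReal)
    (x : EuclideanSpace ℝ (Fin d)) (γ : Config d) : EReal :=
  if h : ∃ Λ, IsBoundedBorel Λ ∧ x ∈ Λ ∧ H Λ γ < ⊤ then
    H h.choose (γ.addPoint x) - H h.choose γ
  else 0

/-- The difference `H_Λ(γ + δ_x) - H_Λ(γ)` is the same for `Λ` as for a smaller `Λ₀`. -/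
theorem energy_sub_eq_of_subset {d : ℕ}
    {H : Set (EuclideanSpace ℝ (Fin d)) → Config d → EReal} (hH : IsEnergyFamily H)
    {x : EuclideanSpace ℝ (Fin d)} {γ : Config d} {Λ₀ Λ : Set (EuclideanSpace ℝ (Fin d))}
    (h₀ : IsBoundedBorel Λ₀) (hΛ : IsBoundedBorel Λ) (hsub : Λ₀ ⊆ Λ) (hx : x ∈ Λ₀)
    (hfin : H Λ γ < ⊤) :
    H Λ (γ.addPoint x) - H Λ γ = H Λ₀ (γ.addPoint x) - H Λ₀ γ := by
  obtain ⟨φ, -, hφ, hc⟩ := hH.compat Λ₀ Λ h₀ hΛ hsub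
  have hr : (γ.addPoint x).restrict Λ₀ᶜ = γ.restrict Λ₀ᶜ := by
    ext z
    simp only [Config.restrict, Config.addPoint, Set.mem_inter_iff, Set.mem_insert_iff,
      Set.mem_compl_iff]
    constructor
    · rintro ⟨rfl | hz, hz'⟩
      · exact absurd hx hz'
      · exact ⟨hz, hz'⟩
    · rintro ⟨hz, hz'⟩
      exact ⟨Or.inr hz, hz'⟩
  have h1 := hH.ne_bot Λ₀ h₀ γ
  have h2 := hH.ne_bot Λ₀ h₀ (γ.addPoint x)
  have h3 := hφ (γ.restrict Λ₀ᶜ)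
  rw [hc γ] at hfin
  rw [hc γ, hc (γ.addPoint x), hr]
  generalize φ (γ.restrict Λ₀ᶜ) = c at *
  generalize H Λ₀ γ = a at *
  generalize H Λ₀ (γ.addPoint x) = b at *
  induction c <;> induction a <;> induction b <;> simp_all [← EReal.coe_add, ← EReal.coe_sub]

/-- The local energy does not depend on the bounded set through which it is computed. -/
theorem localEnergy_eq {d : ℕ}
    {H : Set (EuclideanSpace ℝ (Fin d)) → Config d → EReal} (hH : IsEnergyFamily H)
    {x : EuclideanSpace ℝ (Fin d)} {γ : Config d} {Λ : Set (EuclideanSpace ℝ (Fin d))}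
    (hΛ : IsBoundedBorel Λ) (hx : x ∈ Λ) (hfin : H Λ γ < ⊤) :
    localEnergy H x γ = H Λ (γ.addPoint x) - H Λ γ := by
  have hex : ∃ Λ, IsBoundedBorel Λ ∧ x ∈ Λ ∧ H Λ γ < ⊤ := ⟨Λ, hΛ, hx, hfin⟩
  have hs : IsBoundedBorel ({x} : Set (EuclideanSpace ℝ (Fin d))) :=
    ⟨Bornology.isBounded_singleton, measurableSet_singleton x⟩
  obtain ⟨hb, hxb, hfb⟩ := hex.choose_spec
  rw [localEnergy, dif_pos hex,
    energy_sub_eq_of_subset hH hs hb (Set.singleton_subset_iff.2 hxb) rfl hfb,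
    energy_sub_eq_of_subset hH hs hΛ (Set.singleton_subset_iff.2 hx) rfl hfin]

/-- `∫ f(γ'_Λ + γ_{Λᶜ}) e^{-H_Λ(γ'_Λ + γ_{Λᶜ})} π_Λ(dγ')`. -/
noncomputable def unnormalizedKernel {d : ℕ}
    (H : Set (EuclideanSpace ℝ (Fin d)) → Config d → EReal)
    (Λ : Set (EuclideanSpace ℝ (Fin d))) (f : Config d → ℝ≥0∞) (γ : Config d) : ℝ≥0∞ :=
  ∫⁻ γ', f (Config.glue Λ γ' γ) * EReal.exp (-(H Λ (Config.glue Λ γ' γ))) ∂(poissonProcess Λ)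

/-- The normalization constant `Z_Λ(γ_{Λᶜ})`. -/
noncomputable def partitionFunction {d : ℕ}
    (H : Set (EuclideanSpace ℝ (Fin d)) → Config d → EReal)
    (Λ : Set (EuclideanSpace ℝ (Fin d))) (γ : Config d) : ℝ≥0∞ :=
  unnormalizedKernel H Λ (fun _ => 1) γ

/-- `Ξ_Λ(f, γ)`, the Gibbs kernel applied to a non-negative function. It vanishes where
`Z_Λ(γ_{Λᶜ})` is `0` or `∞`, so that the equations below, for `f = 1`, force
`0 < Z_Λ(γ_{Λᶜ}) < ∞` for almost every `γ`. -/
noncomputable def gibbsKernel {d : ℕ}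
    (H : Set (EuclideanSpace ℝ (Fin d)) → Config d → EReal)
    (Λ : Set (EuclideanSpace ℝ (Fin d))) (f : Config d → ℝ≥0∞) (γ : Config d) : ℝ≥0∞ :=
  open Classical in
  if partitionFunction H Λ γ = 0 ∨ partitionFunction H Λ γ = ∞ then 0
  else unnormalizedKernel H Λ f γ / partitionFunction H Λ γ

/-- Gibbs measures: probability measures that satisfy the Dobrushin–Lanford–Ruelle equations. -/
structure IsGibbs {d : ℕ} (H : Set (EuclideanSpace ℝ (Fin d)) → Config d → EReal)
    (μ : Measure (Config d)) : Prop where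
  isProbabilityMeasure : IsProbabilityMeasure μ
  dlr : ∀ Λ, IsBoundedBorel Λ → ∀ f : Config d → ℝ≥0∞, Measurable f →
    ∫⁻ γ, f γ ∂μ = ∫⁻ γ, gibbsKernel H Λ f γ ∂μ

/-- The set `𝓖` of stationary Gibbs measures. -/
def stationaryGibbs {d : ℕ} (H : Set (EuclideanSpace ℝ (Fin d)) → Config d → EReal) :
    Set (Measure (Config d)) :=
  {μ | IsGibbs H μ ∧ ∀ y, MeasurePreserving (Config.translate y) μ μ}

/-- The values of the hardcore parameter that are admissible for `γ` observed through `Λ`. -/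
def admissibleParameters {d p : ℕ}
    (H : ℝ → EuclideanSpace ℝ (Fin p) → Set (EuclideanSpace ℝ (Fin d)) → Config d → EReal)
    (Λ : Set (EuclideanSpace ℝ (Fin d))) (θ : EuclideanSpace ℝ (Fin p)) (γ : Config d) : Set ℝ :=
  {α | 0 < α ∧ H α θ Λ γ < ⊤}

/-- The hardcore estimator `inf {α > 0 : H_Λ^{α,θ}(γ) < ∞}`. -/
noncomputable def hardcoreEstimator {d p : ℕ}
    (H : ℝ → EuclideanSpace ℝ (Fin p) → Set (EuclideanSpace ℝ (Fin d)) → Config d → EReal)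
    (Λ : Set (EuclideanSpace ℝ (Fin d))) (θ : EuclideanSpace ℝ (Fin p)) (γ : Config d) : ℝ :=
  sInf (admissibleParameters H Λ θ γ)

open Metric

namespace Config

variable {d : ℕ}

/-- An event that only depends on the points of the configuration inside `S`. -/
def DependsOn (B : Set (Config d)) (S : Set (EuclideanSpace ℝ (Fin d))) : Prop :=
  ∀ γ γ' : Config d, γ.carrier ∩ S = γ'.carrier ∩ S → (γ ∈ B ↔ γ' ∈ B)

theorem DependsOn.mono {B : Set (Config d)} {S T : Set (EuclideanSpace ℝ (Fin d))}
    (h : DependsOn B S) (hST : S ⊆ T) : DependsOn B T := fun γ γ' hγ => h γ γ' <| by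
  rw [← Set.inter_eq_self_of_subset_right hST, ← Set.inter_assoc, ← Set.inter_assoc, hγ]

theorem DependsOn.preimage_translate {B : Set (Config d)} {S : Set (EuclideanSpace ℝ (Fin d))}
    (h : DependsOn B S) (y : EuclideanSpace ℝ (Fin d)) :
    DependsOn (translate y ⁻¹' B) ((fun x => x + y) ⁻¹' S) := fun γ γ' hγ => by
  refine h _ _ ?_
  simp only [translate, ← Set.image_inter_preimage, hγ]

theorem DependsOn.glue_mem_iff {B : Set (Config d)} {Λ : Set (EuclideanSpace ℝ (Fin d))}
    (h : DependsOn B Λᶜ) (γ' γ : Config d) : glue Λ γ' γ ∈ B ↔ γ ∈ B := by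
  refine h _ _ ?_
  ext x
  simp only [glue, union, restrict, Set.mem_inter_iff, Set.mem_union, Set.mem_compl_iff]
  tauto

/-- The local events: the measurable events that only depend on the points in some ball. -/
def localEvents (d : ℕ) : Set (Set (Config d)) :=
  {B | MeasurableSet B ∧ ∃ r : ℝ, DependsOn B (closedBall 0 r)}

theorem isSetAlgebra_localEvents : IsSetAlgebra (localEvents d) where
  empty_mem := ⟨MeasurableSet.empty, 0, fun _ _ _ => Iff.rfl⟩
  compl_mem := by
    rintro B ⟨hB, r, hr⟩
    exact ⟨hB.compl, r, fun γ γ' h => not_congr (hr γ γ' h)⟩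
  union_mem := by
    rintro B C ⟨hB, r, hr⟩ ⟨hC, s, hs⟩
    have h₁ := hr.mono (closedBall_subset_closedBall (le_max_left r s))
    have h₂ := hs.mono (closedBall_subset_closedBall (le_max_right r s))
    exact ⟨hB.union hC, max r s, fun γ γ' h => or_congr (h₁ γ γ' h) (h₂ γ γ' h)⟩

theorem generateFrom_localEvents :
    (inferInstance : MeasurableSpace (Config d)) =
      MeasurableSpace.generateFrom (localEvents d) := by
  refine le_antisymm (MeasurableSpace.generateFrom_le ?_)
    (MeasurableSpace.generateFrom_le fun B hB => hB.1)
  rintro _ ⟨Λ, n, hΛ, rfl⟩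
  obtain ⟨r, hr⟩ := hΛ.1.subset_closedBall 0
  refine MeasurableSpace.measurableSet_generateFrom
    ⟨MeasurableSpace.measurableSet_generateFrom ⟨Λ, n, hΛ, rfl⟩, r, ?_⟩
  refine DependsOn.mono (S := Λ) (fun γ γ' h => ?_) hr
  simp only [Set.mem_ofPred_eq, count, h]

theorem exists_preimage_add_subset_compl (hd : 1 ≤ d) {Λ : Set (EuclideanSpace ℝ (Fin d))}
    (hΛ : Bornology.IsBounded Λ) (r : ℝ) :
    ∃ y : EuclideanSpace ℝ (Fin d), (fun x => x + y) ⁻¹' closedBall 0 r ⊆ Λᶜ := by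
  obtain ⟨s, hs⟩ := hΛ.subset_closedBall 0
  have : Nonempty (Fin d) := ⟨⟨0, hd⟩⟩
  obtain ⟨y, hy⟩ := NormedSpace.exists_lt_norm ℝ (EuclideanSpace ℝ (Fin d)) (r + s)
  refine ⟨y, fun x hx hxΛ => ?_⟩
  have h₁ : ‖x‖ ≤ s := mem_closedBall_zero_iff.1 (hs hxΛ)
  have h₂ : ‖x + y‖ ≤ r := mem_closedBall_zero_iff.1 hx
  have h₃ : ‖y‖ ≤ ‖x + y‖ + ‖x‖ := by simpa using norm_sub_le (x + y) x
  linarith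

/-- Under a stationary law, a translation invariant event coincides almost surely with an event
that does not depend on the points in a given bounded set. -/
theorem exists_dependsOn_compl_ae_eq (hd : 1 ≤ d) {μ : Measure (Config d)} [IsFiniteMeasure μ]
    (hμ : ∀ y, MeasurePreserving (translate y) μ μ) {A : Set (Config d)} (hA : MeasurableSet A)
    (hinv : ∀ y, translate y ⁻¹' A = A) {Λ : Set (EuclideanSpace ℝ (Fin d))}
    (hΛ : Bornology.IsBounded Λ) :
    ∃ A' : Set (Config d), MeasurableSet A' ∧ DependsOn A' Λᶜ ∧ A =ᵐ[μ] A' := by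
  have happrox : ∀ k : ℕ, ∃ B : Set (Config d), MeasurableSet B ∧ DependsOn B Λᶜ ∧
      μ (symmDiff A B) ≤ ENNReal.ofReal ((1 / 2) ^ k) := by
    intro k
    obtain ⟨B, ⟨hB, r, hr⟩, hAB⟩ :=
      (Measure.MeasureDense.of_generateFrom_isSetAlgebra_finite (μ := μ)
        isSetAlgebra_localEvents generateFrom_localEvents).approx A hA (measure_ne_top μ A)
        ((1 / 2) ^ k) (by positivity)
    obtain ⟨y, hy⟩ := exists_preimage_add_subset_compl hd hΛ r
    refine ⟨translate y ⁻¹' B, (hμ y).measurable hB, (hr.preimage_translate y).mono hy, ?_⟩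
    conv_lhs => rw [← hinv y]
    rw [← Set.preimage_symmDiff, (hμ y).measure_preimage (hA.symmDiff hB).nullMeasurableSet]
    exact hAB.le
  choose B hB hdep hAB using happrox
  have hsum : ∑' k, μ (symmDiff A (B k)) ≠ ∞ := by
    refine ne_top_of_le_ne_top ?_ (ENNReal.tsum_le_tsum hAB)
    exact (summable_geometric_of_lt_one (by norm_num : (0 : ℝ) ≤ 1 / 2)
      (by norm_num)).tsum_ofReal_ne_top
  refine ⟨limsup B atTop, MeasurableSet.measurableSet_limsup hB, fun γ γ' h => ?_, ?_⟩
  · simp only [mem_limsup_iff_frequently_mem]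
    exact frequently_congr (Eventually.of_forall fun k => hdep k γ γ' h)
  · filter_upwards [ae_eventually_notMem hsum] with γ hγ
    refine propext ?_
    change γ ∈ A ↔ γ ∈ limsup B atTop
    rw [mem_limsup_iff_frequently_mem]
    have hiff : ∀ᶠ k in atTop, (γ ∈ B k ↔ γ ∈ A) := by
      filter_upwards [hγ] with k hk
      rw [Set.mem_symmDiff] at hk
      tauto
    rw [frequently_congr hiff, frequently_const]

end Config

section Gibbs

variable {d : ℕ} {H : Set (EuclideanSpace ℝ (Fin d)) → Config d → EReal}

/-- The Gibbs kernel commutes with restriction to events that do not depend on the points in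
`Λ`. -/
theorem gibbsKernel_indicator {Λ : Set (EuclideanSpace ℝ (Fin d))} {A : Set (Config d)}
    (hA : Config.DependsOn A Λᶜ) (f : Config d → ℝ≥0∞) :
    gibbsKernel H Λ (A.indicator f) = A.indicator (gibbsKernel H Λ f) := by
  funext γ
  by_cases hγ : γ ∈ A
  · rw [Set.indicator_of_mem hγ]
    have h : ∀ γ', A.indicator f (Config.glue Λ γ' γ) = f (Config.glue Λ γ' γ) := fun γ' =>
      Set.indicator_of_mem ((hA.glue_mem_iff γ' γ).2 hγ) f
    simp only [gibbsKernel, unnormalizedKernel, h]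
  · rw [Set.indicator_of_notMem hγ]
    have h : ∀ γ', A.indicator f (Config.glue Λ γ' γ) = 0 := fun γ' =>
      Set.indicator_of_notMem (fun h => hγ ((hA.glue_mem_iff γ' γ).1 h)) f
    simp [gibbsKernel, unnormalizedKernel, h]

theorem IsGibbs.ae_energy_lt_top {μ : Measure (Config d)} (hμ : IsGibbs H μ)
    {Λ : Set (EuclideanSpace ℝ (Fin d))} (hΛ : IsBoundedBorel Λ) (hH : Measurable (H Λ)) :
    ∀ᵐ γ ∂μ, H Λ γ < ⊤ := by
  have hmeas : MeasurableSet {γ | H Λ γ = ⊤} := hH (measurableSet_singleton ⊤)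
  have hzero : ∀ γ, gibbsKernel H Λ ({γ | H Λ γ = ⊤}.indicator 1) γ = 0 := by
    intro γ
    have h : ∀ γ', ({γ | H Λ γ = ⊤}.indicator (1 : Config d → ℝ≥0∞)) (Config.glue Λ γ' γ) *
        EReal.exp (-(H Λ (Config.glue Λ γ' γ))) = 0 := by
      intro γ'
      by_cases hγ : H Λ (Config.glue Λ γ' γ) = ⊤
      · simp [hγ]
      · rw [Set.indicator_of_notMem (by simpa using hγ), zero_mul]
    simp [gibbsKernel, unnormalizedKernel, h]
  have := hμ.dlr Λ hΛ _ (measurable_one.indicator hmeas)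
  rw [lintegral_indicator_one hmeas, lintegral_congr hzero, lintegral_zero] at this
  rw [ae_iff]
  simpa only [not_lt, top_le_iff] using this

/-- Conditioning a stationary Gibbs measure on a translation invariant event gives a stationary
Gibbs measure. -/
theorem smul_restrict_mem_stationaryGibbs (hd : 1 ≤ d) {μ : Measure (Config d)}
    (hμ : μ ∈ stationaryGibbs H) {A : Set (Config d)} (hA : MeasurableSet A)
    (hinv : ∀ y, Config.translate y ⁻¹' A = A) (hA₀ : μ A ≠ 0) :
    (μ A)⁻¹ • μ.restrict A ∈ stationaryGibbs H := by
  have := hμ.1.isProbabilityMeasure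
  refine ⟨⟨⟨?_⟩, fun Λ hΛ f hf => ?_⟩, fun y => ?_⟩
  · simp [ENNReal.inv_mul_cancel hA₀ (measure_ne_top μ A)]
  · obtain ⟨A', hA', hdep, hae⟩ := Config.exists_dependsOn_compl_ae_eq hd hμ.2 hA hinv hΛ.1
    rw [lintegral_smul_measure, lintegral_smul_measure, Measure.restrict_congr_set hae,
      ← lintegral_indicator hA', ← lintegral_indicator hA', hμ.1.dlr Λ hΛ _ (hf.indicator hA'),
      gibbsKernel_indicator hdep]
  · have h := (hμ.2 y).restrict_preimage hA
    rw [hinv y] at h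
    exact h.smul_measure _

end Gibbs

/-- An increasing sequence of convex compact sets that covers the space eventually contains any
given bounded set. -/
theorem exists_subset_of_monotone_convex_compact {E : Type*} [NormedAddCommGroup E]
    [NormedSpace ℝ E] [FiniteDimensional ℝ E] {W : ℕ → Set E} (hmono : Monotone W)
    (hconv : ∀ n, Convex ℝ (W n)) (hcomp : ∀ n, IsCompact (W n)) (huniv : ⋃ n, W n = Set.univ)
    {B : Set E} (hB : Bornology.IsBounded B) : ∃ n, B ⊆ W n := by
  have := FiniteDimensional.proper ℝ E
  obtain ⟨m, z, hz⟩ :=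
    nonempty_interior_of_iUnion_of_closed (fun n => (hcomp n).isClosed) huniv
  have hcover : ∀ x, ∃ n, x ∈ interior (W n) := by
    intro x
    obtain ⟨k, hk⟩ := Set.mem_iUnion.1 (huniv ▸ Set.mem_univ (x + (x - z)))
    refine ⟨max m k, (hconv _).openSegment_interior_self_subset_interior
      (interior_mono (hmono (le_max_left m k)) hz) (hmono (le_max_right m k) hk)
      ⟨1 / 2, 1 / 2, by norm_num, by norm_num, by norm_num, ?_⟩⟩
    module
  obtain ⟨r, hr⟩ := hB.subset_closedBall (0 : E)
  obtain ⟨n, hn⟩ := (isCompact_closedBall (0 : E) r).elim_directed_cover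
    (fun n => interior (W n)) (fun n => isOpen_interior)
    (fun x _ => Set.mem_iUnion.2 (hcover x))
    (Monotone.directed_le fun i j hij => interior_mono (hmono hij))
  exact ⟨n, hr.trans (hn.trans interior_subset)⟩

section Energy

variable {d : ℕ} {H : Set (EuclideanSpace ℝ (Fin d)) → Config d → EReal}

theorem IsEnergyFamily.lt_top_of_subset (hH : IsEnergyFamily H)
    {Λ Λ' : Set (EuclideanSpace ℝ (Fin d))} (hΛ : IsBoundedBorel Λ) (hΛ' : IsBoundedBorel Λ')
    (hsub : Λ ⊆ Λ') {γ : Config d} (h : H Λ' γ < ⊤) : H Λ γ < ⊤ := by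
  obtain ⟨φ, -, hφ, hc⟩ := hH.compat Λ Λ' hΛ hΛ' hsub
  rw [hc γ] at h
  refine lt_top_iff_ne_top.2 fun htop => h.ne ?_
  rw [htop, EReal.top_add_of_ne_bot (hφ _)]

theorem IsCompact.isBoundedBorel {Λ : Set (EuclideanSpace ℝ (Fin d))} (h : IsCompact Λ) :
    IsBoundedBorel Λ :=
  ⟨h.isBounded, h.measurableSet⟩

theorem locallyFiniteEnergy_eq_iInter (hH : IsEnergyFamily H)
    {W : ℕ → Set (EuclideanSpace ℝ (Fin d))} (hmono : Monotone W)
    (hconv : ∀ n, Convex ℝ (W n)) (hcomp : ∀ n, IsCompact (W n))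
    (huniv : ⋃ n, W n = Set.univ) :
    locallyFiniteEnergy H = ⋂ n, {γ | H (W n) γ < ⊤} := by
  ext γ
  simp only [locallyFiniteEnergy, Set.mem_ofPred_eq, Set.mem_iInter]
  refine ⟨fun h n => h _ (hcomp n).isBoundedBorel, fun h Λ hΛ => ?_⟩
  obtain ⟨n, hn⟩ := exists_subset_of_monotone_convex_compact hmono hconv hcomp huniv hΛ.1
  exact hH.lt_top_of_subset hΛ (hcomp n).isBoundedBorel hn (h n)

theorem Config.translate_neg_translate (y : EuclideanSpace ℝ (Fin d)) (γ : Config d) :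
    (γ.translate y).translate (-y) = γ := by
  ext x
  simp [Config.translate]

/-- If every stationary Gibbs measure charges the configurations with infinite energy for `H'` in
some fixed bounded set, then the configurations of locally finite `H'`-energy are negligible. -/
theorem measure_locallyFiniteEnergy_eq_zero (hd : 1 ≤ d)
    {H' : Set (EuclideanSpace ℝ (Fin d)) → Config d → EReal} {μ : Measure (Config d)}
    (hμ : μ ∈ stationaryGibbs H) (hmeas : MeasurableSet (locallyFiniteEnergy H'))
    (hinv : ∀ γ ∈ locallyFiniteEnergy H', ∀ y, γ.translate y ∈ locallyFiniteEnergy H')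
    {Λ : Set (EuclideanSpace ℝ (Fin d))} (hΛ : IsBoundedBorel Λ)
    (hpos : ∀ ν ∈ stationaryGibbs H, 0 < ν {γ | H' Λ γ = ⊤}) :
    μ (locallyFiniteEnergy H') = 0 := by
  by_contra h₀
  have hinv' : ∀ y, Config.translate y ⁻¹' locallyFiniteEnergy H' = locallyFiniteEnergy H' := by
    intro y
    ext γ
    refine ⟨fun h => ?_, fun h => hinv γ h y⟩
    simpa only [Config.translate_neg_translate] using hinv _ h (-y)
  refine (hpos _ (smul_restrict_mem_stationaryGibbs hd hμ hmeas hinv' h₀)).ne' ?_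
  have hdisj : {γ | H' Λ γ = ⊤} ∩ locallyFiniteEnergy H' = ∅ :=
    Set.eq_empty_of_forall_notMem fun γ hγ => (hγ.2 Λ hΛ).ne hγ.1
  simp [Measure.restrict_apply' hmeas, hdisj]

end Energy

theorem proposition3 {d p : ℕ} (hd : 1 ≤ d)
    -- the parameter set and the true parameters
    (Θ : Set (EuclideanSpace ℝ (Fin p))) (hΘ_open : IsOpen Θ)
    (hΘ_bdd : Bornology.IsBounded Θ)
    (αs : ℝ) (hαs : 0 < αs) (θs : EuclideanSpace ℝ (Fin p)) (hθs : θs ∈ Θ)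
    -- the parametric family of energies
    (H : ℝ → EuclideanSpace ℝ (Fin p) → Set (EuclideanSpace ℝ (Fin d)) → Config d → EReal)
    (hH : ∀ α, 0 < α → ∀ θ ∈ Θ, IsEnergyFamily (H α θ))
    -- the support of the energy does not depend on `θ`
    (hS1 : ∀ γ α, 0 < α → ∀ θ ∈ Θ, ∀ θ' ∈ Θ, ∀ Λ, IsBoundedBorel Λ →
      (H α θ Λ γ < ⊤ ↔ H α θ' Λ γ < ⊤))
    -- the support of the energy increases with `α`
    (hS2 : ∀ γ α α', 0 < α → 0 < α' → ∀ θ ∈ Θ, ∀ Λ, IsBoundedBorel Λ →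
      α ≤ α' → H α θ Λ γ < ⊤ → H α' θ Λ γ < ⊤)
    -- an underestimated `α` forbids configurations that occur with positive probability
    (hS3 : ∀ α, 0 < α → α < αs → ∃ R : ℝ, 0 < R ∧ ∀ ν ∈ stationaryGibbs (H αs θs),
      0 < ν {γ | H α θs (Metric.ball 0 R) γ = ⊤})
    -- the observation windows
    (W : ℕ → Set (EuclideanSpace ℝ (Fin d)))
    (hW_mono : Monotone W) (hW_convex : ∀ n, Convex ℝ (W n)) (hW_compact : ∀ n, IsCompact (W n))
    (hW_univ : ⋃ n, W n = Set.univ)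
    -- the local energy, and with it its domain, is invariant under translation
    (hH2 : ∀ α, 0 < α → ∀ θ ∈ Θ, ∀ γ ∈ locallyFiniteEnergy (H α θ), ∀ y,
      γ.translate y ∈ locallyFiniteEnergy (H α θ) ∧
        ∀ x, x ∉ γ.carrier →
          localEnergy (H α θ) (x + y) (γ.translate y) = localEnergy (H α θ) x γ)
    -- local stability
    (hH3 : ∃ K : ℝ, 0 ≤ K ∧ ∀ α, 0 < α → ∀ θ ∈ Θ, ∀ γ ∈ locallyFiniteEnergy (H α θ),
      ∀ x, x ∉ γ.carrier → ((-K : ℝ) : EReal) ≤ localEnergy (H α θ) x γ)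
    -- the law of the observed configuration
    (μ : Measure (Config d)) (hμ : μ ∈ stationaryGibbs (H αs θs)) :
    ∀ᵐ γ ∂μ, ∀ θ ∈ Θ,
      (∀ n, (admissibleParameters H (W n) θ γ).Nonempty) ∧
      Monotone (fun n => hardcoreEstimator H (W n) θ γ) ∧
      (∀ n, hardcoreEstimator H (W n) θ γ ≤ αs) ∧
      Tendsto (fun n => hardcoreEstimator H (W n) θ γ) atTop (𝓝 αs) := by
  have hαE := hH αs hαs θs hθs
  have hWB : ∀ n, IsBoundedBorel (W n) := fun n => (hW_compact n).isBoundedBorel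
  have hfin : ∀ᵐ γ ∂μ, ∀ n, H αs θs (W n) γ < ⊤ :=
    ae_all_iff.2 fun n => hμ.1.ae_energy_lt_top (hWB n) (hαE.measurable _ (hWB n))
  have hinf : ∀ α, 0 < α → α < αs → ∀ᵐ γ ∂μ, ∃ n, H α θs (W n) γ = ⊤ := by
    intro α hα hlt
    obtain ⟨R, -, hR⟩ := hS3 α hα hlt
    have hE := hH α hα θs hθs
    have heq := locallyFiniteEnergy_eq_iInter hE hW_mono hW_convex hW_compact hW_univ
    have hmeas : MeasurableSet (locallyFiniteEnergy (H α θs)) := by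
      rw [heq]
      exact MeasurableSet.iInter fun n => hE.measurable _ (hWB n) measurableSet_Iio
    have hnull := measure_locallyFiniteEnergy_eq_zero hd hμ hmeas
      (fun γ hγ y => (hH2 α hα θs hθs γ hγ y).1) ⟨Metric.isBounded_ball, measurableSet_ball⟩ hR
    filter_upwards [measure_eq_zero_iff_ae_notMem.1 hnull] with γ hγ
    rw [heq, Set.mem_iInter] at hγ
    obtain ⟨n, hn⟩ := not_forall.1 hγ
    exact ⟨n, not_lt_top_iff.1 hn⟩
  obtain ⟨u, -, hu, hulim⟩ := exists_seq_strictMono_tendsto' hαs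
  filter_upwards [hfin, ae_all_iff.2 fun k => hinf (u k) (hu k).1 (hu k).2] with γ hγ hγu θ hθ
  have hmem : ∀ n, αs ∈ admissibleParameters H (W n) θ γ := fun n =>
    ⟨hαs, (hS1 γ αs hαs θs hθs θ hθ _ (hWB n)).1 (hγ n)⟩
  have hbdd : ∀ n, BddBelow (admissibleParameters H (W n) θ γ) := fun n =>
    ⟨0, fun α hα => hα.1.le⟩
  have hmono : Monotone fun n => hardcoreEstimator H (W n) θ γ := fun m n hmn =>
    csInf_le_csInf (hbdd m) ⟨αs, hmem n⟩ fun α hα =>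
      ⟨hα.1, (hH α hα.1 θ hθ).lt_top_of_subset (hWB m) (hWB n) (hW_mono hmn) hα.2⟩
  have hle : ∀ n, hardcoreEstimator H (W n) θ γ ≤ αs := fun n => csInf_le (hbdd n) (hmem n)
  refine ⟨fun n => ⟨αs, hmem n⟩, hmono, hle, tendsto_order.2 ⟨fun c hc => ?_, fun c hc =>
    Eventually.of_forall fun n => (hle n).trans_lt hc⟩⟩
  obtain ⟨k, hk⟩ := (hulim.eventually (lt_mem_nhds hc)).exists
  obtain ⟨n₀, hn₀⟩ := hγu k
  filter_upwards [eventually_ge_atTop n₀] with n hn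
  refine hk.trans_le (le_trans (le_csInf ⟨αs, hmem n₀⟩ fun α hα => ?_) (hmono hn))
  by_contra! hlt
  exact ((hS1 γ (u k) (hu k).1 θ hθ θs hθs _ (hWB n₀)).1
    (hS2 γ α (u k) hα.1 (hu k).1 θ hθ _ (hWB n₀) hlt.le hα.2)).ne hn₀
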